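/- Work with formal Laurent series over $\mathbb{C}$ in $t^{-1}$ (expansions at $t=\infty$). For such a series let $\left[\sum_{n} a_n t^n\right]_+=\sum_{n\ge 0}a_nt^n$, which is a polynomial in $t$, and put $[f(t)\,dt]_+=[f(t)]_+\,dt$. Let $$w(t)=-\frac1t-\log\Big(1-\frac1t\Big)=\sum_{m\ge 2}\frac{1}{m}\,t^{-m},$$ let $v(t)=t^{-1}+\frac13t^{-2}+\cdots$ be the solution of $\frac12 v(t)^2=w(t)$ with leading term $t^{-1}$, and let $s(t)=-t+\frac23+\cdots$ be the solution $s(t)\neq t$ of $w(s(t))=w(t)$ for which $1/s(t)$ is a power series in $t^{-1}$ without constant term. Define polynomials $\hat\xi_n(t)$, $n\ge0$, by $\hat\xi_0(t)=t-1$ and $\hat\xi_{n+1}(t)=t^2(t-1)\frac{d}{dt}\hat\xi_n(t)$. For integers $a,b\ge 0$ define the residue polynomial $P_{a,b}(t)$ by $$P_{a,b}(t)\,dt=\frac12\left[\frac{t\,s(t)}{t-s(t)}\,\frac{dt}{t^2(t-1)}\Big(\hat\xi_{a+1}(t)\hat\xi_{b+1}(s(t))+\hat\xi_{a+1}(s(t))\hat\xi_{b+1}(t)\Big)\right]_+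 .$$ Define $s_k$, $k\ge 0$, by $\sum_{k\ge0}s_kN^{-k}=\exp\Big(-\sum_{r\ge1}\frac{B_{2r}}{2r(2r-1)}N^{-2r+1}\Big)$, with $B_{2r}$ the Bernoulli numbers, and for $n\in\mathbb{Z}$ the Laurent series $$\eta_n(v)=\frac1v\sum_{k\ge0}s_k\,\frac{(2(n-k)-1)!!}{v^{2(n-k)}},$$ where $(-1)!!=1$ and $(-2j-1)!!=\frac{(-1)^j}{(2j-1)!!}$ for $j\ge1$. Then $$\eta_{-1}(v)=-v\Big(1+\sum_{k\ge1}(-1)^k s_k\frac{1}{(2k+1)!!}v^{2k}\Big),$$ and the reciprocal of $\eta_{-1}$ as a Laurent series in $v$ is $$\frac1{\eta_{-1}(v)}=-\frac1v\left(1+\sum_{m\ge1}\Big(\sum_{k\ge1}(-1)^{k-1}s_k\frac{1}{(2k+1)!!}v^{2k}\Big)^m\right).$$ With this reciprocal, for all integers $a,b\ge0$, $$P_{a,b}(t)\,dt=\frac12\left[\left.\frac{\eta_{a+1}(v)\,\eta_{b+1}(v)}{\eta_{-1}(v)}\;v\,dv\right|_{v=v(t)}\right]_+ .$$ -/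

import Mathlib

open scoped Nat PowerSeries LaurentSeries

noncomputable section

namespace Lambert

/-! Laurent series at `t = ∞` on the Lambert curve are elements of `ℂ⸨X⸩`, where `X` stands for
`t⁻¹`.  The functions `η_n` are Laurent series in `v`; there `X` stands for `v`. -/

/-- `w(t) = -1/t - log (1 - 1/t) = ∑_{m ≥ 2} (1/m) t^{-m}`, as a power series in `t⁻¹`. -/
def w : ℂ⟦X⟧ := PowerSeries.mk fun m => if 2 ≤ m then (1 : ℂ) / m else 0

lemma exists_sqrt {h : ℂ⟦X⟧} (hh : PowerSeries.constantCoeff h = 1) :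
    ∃ g : ℂ⟦X⟧, PowerSeries.constantCoeff g = 1 ∧ g ^ 2 = h := by
  have hs : PowerSeries.HasSubst (h - 1) :=
    PowerSeries.HasSubst.of_constantCoeff_zero' (by simp [hh])
  have hz : PowerSeries.constantCoeff (h - 1) = 0 := by simp [hh]
  have hsq : (PowerSeries.binomialSeries ℂ (1 / 2 : ℂ)) ^ 2 = 1 + PowerSeries.X := by
    rw [sq, ← PowerSeries.binomialSeries_add]
    have := PowerSeries.binomialSeries_nat (R := ℂ) (A := ℂ) 1
    norm_num at this ⊢
    exact this
  refine ⟨(PowerSeries.binomialSeries ℂ (1 / 2 : ℂ)).subst (h - 1), ?_, ?_⟩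
  · have h0 : PowerSeries.constantCoeff
        (PowerSeries.binomialSeries ℂ (1 / 2 : ℂ) - 1) = 0 := by simp
    have h1 := PowerSeries.constantCoeff_subst_eq_zero hz _ h0
    have e1 : (1 : ℂ⟦X⟧).subst (h - 1) = 1 := by
      rw [← PowerSeries.coe_substAlgHom hs, map_one]
    rw [PowerSeries.subst_sub hs, e1] at h1
    have h2 : PowerSeries.constantCoeff
        ((PowerSeries.binomialSeries ℂ (1 / 2 : ℂ)).subst (h - 1) - 1 : ℂ⟦X⟧) = 0 := h1
    rw [map_sub, sub_eq_zero] at h2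
    simpa using h2
  · rw [← PowerSeries.subst_pow hs, hsq, PowerSeries.subst_add hs, PowerSeries.subst_X hs]
    have e1 : (1 : ℂ⟦X⟧).subst (h - 1) = 1 := by
      rw [← PowerSeries.coe_substAlgHom hs, map_one]
    rw [e1]; ring

/-- There is exactly one branch `v = t⁻¹ + O(t⁻²)` of the solution of `v² / 2 = w(t)`. -/
theorem existsUnique_v : ∃! v : ℂ⟦X⟧,
    PowerSeries.constantCoeff v = 0 ∧ PowerSeries.coeff 1 v = 1 ∧
      PowerSeries.C (1 / 2 : ℂ) * v ^ 2 = w := by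
  obtain ⟨g, hg, hg2⟩ := exists_sqrt
    (h := PowerSeries.mk fun m : ℕ => (2 : ℂ) / (m + 2))
    (by rw [← PowerSeries.coeff_zero_eq_constantCoeff_apply]; simp)
  have hw : PowerSeries.C (1 / 2 : ℂ) * (PowerSeries.X * g) ^ 2 = w := by
    rw [mul_pow, hg2]
    ext n
    rw [PowerSeries.coeff_C_mul, w, PowerSeries.coeff_mk]
    split_ifs with hn
    · obtain ⟨k, rfl⟩ := Nat.exists_eq_add_of_le' hn
      rw [PowerSeries.coeff_X_pow_mul, PowerSeries.coeff_mk]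
      push_cast
      ring
    · rw [PowerSeries.coeff_X_pow_mul', if_neg hn, mul_zero]
  refine ⟨PowerSeries.X * g, ⟨by simp, ?_, hw⟩, ?_⟩
  · rw [show (1 : ℕ) = 0 + 1 from rfl, PowerSeries.coeff_succ_X_mul]
    simpa using hg
  · rintro y ⟨-, hy1, hyw⟩
    have hC : (PowerSeries.C (1 / 2 : ℂ)) ≠ 0 := by
      intro h
      have := congrArg PowerSeries.constantCoeff h
      simp at this
    have hsq : y ^ 2 = (PowerSeries.X * g) ^ 2 := mul_left_cancel₀ hC (hyw.trans hw.symm)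
    rcases sq_eq_sq_iff_eq_or_eq_neg.mp hsq with h | h
    · exact h
    · exfalso
      rw [h, map_neg, show (1 : ℕ) = 0 + 1 from rfl, PowerSeries.coeff_succ_X_mul] at hy1
      simp [hg] at hy1
      norm_num at hy1

/-- `v(t) = t⁻¹ + (1/3) t⁻² + ⋯`, as a power series in `t⁻¹`: the solution of `v² / 2 = w(t)` with
leading term `t⁻¹`. -/
def v : ℂ⟦X⟧ := Classical.choose existsUnique_v.exists

theorem v_spec : PowerSeries.constantCoeff v = 0 ∧ PowerSeries.coeff 1 v = 1 ∧
    PowerSeries.C (1 / 2 : ℂ) * v ^ 2 = w :=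
  Classical.choose_spec existsUnique_v.exists

/-- Besides `σ = t⁻¹` itself, the equation `w` at `σ⁻¹` equals `w(t)` has exactly one solution `σ`
among the power series in `t⁻¹` without constant term. -/
theorem existsUnique_sigma : ∃! σ : ℂ⟦X⟧,
    PowerSeries.constantCoeff σ = 0 ∧ σ ≠ PowerSeries.X ∧
      w.subst σ = w := by
  obtain ⟨hv0, hv1, hvw⟩ := v_spec
  have hu : IsUnit (PowerSeries.coeff 1 v) := by rw [hv1]; exact isUnit_one
  set τ := PowerSeries.substInvOfIsUnit v hu with hτ
  have hvs : PowerSeries.HasSubst v := PowerSeries.HasSubst.of_constantCoeff_zero' hv0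
  have hnvs : PowerSeries.HasSubst (-v) :=
    PowerSeries.HasSubst.of_constantCoeff_zero' (by simp [hv0])
  have hτ0 : PowerSeries.constantCoeff τ = 0 := PowerSeries.constantCoeff_substInvOfIsUnit ..
  have hτs : PowerSeries.HasSubst τ := PowerSeries.HasSubst.of_constantCoeff_zero' hτ0
  have hr : v.subst τ = (PowerSeries.X : ℂ⟦X⟧) :=
    PowerSeries.subst_substInvOfIsUnit_right (P := v) hv0 hu
  have hl : τ.subst v = (PowerSeries.X : ℂ⟦X⟧) :=
    PowerSeries.subst_substInvOfIsUnit_left (P := v) hv0 hu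
  have hsol : ∀ σ : ℂ⟦X⟧, PowerSeries.HasSubst σ →
      w.subst σ = PowerSeries.C (1 / 2 : ℂ) * (v.subst σ : ℂ⟦X⟧) ^ 2 := by
    intro σ hσ
    conv_lhs => rw [← hvw]
    rw [PowerSeries.subst_mul hσ, PowerSeries.subst_pow hσ]
    congr 1
    exact PowerSeries.subst_C _
  have hkey : v.subst (τ.subst (-v) : ℂ⟦X⟧) = -v := by
    rw [← PowerSeries.subst_comp_subst_apply hτs hnvs, hr, PowerSeries.subst_X hnvs]
  have hσ0 : PowerSeries.constantCoeff (τ.subst (-v) : ℂ⟦X⟧) = 0 :=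
    PowerSeries.constantCoeff_subst_eq_zero (by change PowerSeries.constantCoeff (-v) = 0; simp [hv0]) _ hτ0
  refine ⟨τ.subst (-v), ⟨hσ0, ?_, ?_⟩, ?_⟩
  · intro h
    rw [h, PowerSeries.X_subst] at hkey
    have := congrArg (PowerSeries.coeff 1) hkey
    rw [map_neg, hv1] at this
    norm_num at this
  · rw [hsol _ (PowerSeries.HasSubst.of_constantCoeff_zero' hσ0), hkey, neg_sq, hvw]
  · rintro σ ⟨h0, hX, hσw⟩
    have hσ := PowerSeries.HasSubst.of_constantCoeff_zero' h0
    have hC : (PowerSeries.C (1 / 2 : ℂ)) ≠ 0 := by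
      intro h
      have := congrArg PowerSeries.constantCoeff h
      simp at this
    rw [hsol σ hσ] at hσw
    have hsq := mul_left_cancel₀ hC (hσw.trans hvw.symm)
    have hback : τ.subst (v.subst σ : ℂ⟦X⟧) = σ := by
      rw [← PowerSeries.subst_comp_subst_apply hvs hσ, hl, PowerSeries.subst_X hσ]
    rcases sq_eq_sq_iff_eq_or_eq_neg.mp hsq with h | h
    · rw [h, hl] at hback
      exact absurd hback.symm hX
    · rw [h] at hback
      exact hback.symm

/-- `1 / s(t)` as a power series in `t⁻¹`, where `s(t)` is the deck transformation near `t = ∞`,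
the solution `s(t) ≠ t` of `w(s(t)) = w(t)`. -/
def sigma : ℂ⟦X⟧ := Classical.choose existsUnique_sigma.exists

theorem sigma_spec : PowerSeries.constantCoeff sigma = 0 ∧ sigma ≠ PowerSeries.X ∧
    w.subst sigma = w :=
  Classical.choose_spec existsUnique_sigma.exists

/-- The coordinate `t` as a Laurent series in `t⁻¹`. -/
def t : ℂ⸨X⸩ := HahnSeries.single (-1) 1

/-- `s(t) = -t + 2/3 + ⋯` as a Laurent series in `t⁻¹`. -/
def s : ℂ⸨X⸩ := (HahnSeries.ofPowerSeries ℤ ℂ sigma)⁻¹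

/-- `d/dt` on Laurent series in `t⁻¹`: with `X = t⁻¹` it is `-X² d/dX`. -/
def ddt (f : ℂ⸨X⸩) : ℂ⸨X⸩ := -(HahnSeries.single 2 1 * LaurentSeries.derivative ℂ f)

/-- `[f]_+`: the part of a Laurent series in `t⁻¹` with non-negative powers of `t`, as a
polynomial in `t`. -/
def polyPart (f : ℂ⸨X⸩) : Polynomial ℂ :=
  ∑ n ∈ Finset.range ((-f.order).toNat + 1), Polynomial.monomial n (f.coeff (-(n : ℤ)))

theorem coeff_polyPart (f : ℂ⸨X⸩) (n : ℕ) : (polyPart f).coeff n = f.coeff (-(n : ℤ)) := by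
  classical
  rw [polyPart, Polynomial.finsetSum_coeff]
  simp only [Polynomial.coeff_monomial]
  rw [Finset.sum_ite_eq' (Finset.range _) n]
  split_ifs with h
  · rfl
  · rw [Finset.mem_range] at h
    exact (HahnSeries.coeff_eq_zero_of_lt_order (by omega)).symm

/-- The polynomials `ξ̂_n(t)`, `n ≥ 0`. -/
def xiHat : ℕ → Polynomial ℂ
  | 0 => Polynomial.X - 1
  | n + 1 => Polynomial.X ^ 2 * (Polynomial.X - 1) * Polynomial.derivative (xiHat n)

/-- `P_{a,b}(t)`. -/
def residuePolynomial (a b : ℕ) : Polynomial ℂ :=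
  Polynomial.C (1 / 2) * polyPart
    (t * s / (t - s) * (1 / (t ^ 2 * (t - 1))) *
      (Polynomial.aeval t (xiHat (a + 1)) * Polynomial.aeval s (xiHat (b + 1)) +
        Polynomial.aeval s (xiHat (a + 1)) * Polynomial.aeval t (xiHat (b + 1))))

/-- `-∑_{r ≥ 1} B_{2r} / (2r (2r-1)) y^{2r-1}`, where `y` stands for `N⁻¹`. -/
def stirlingExponent : ℂ⟦X⟧ :=
  PowerSeries.mk fun n => if Odd n then -((bernoulli (n + 1) : ℂ) / ((n + 1) * n)) else 0

/-- The Stirling coefficients: `∑ s_k y^k = exp (-∑_{r ≥ 1} B_{2r} / (2r (2r-1)) y^{2r-1})`. -/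
def stirlingCoeff (k : ℕ) : ℂ :=
  PowerSeries.coeff k ((PowerSeries.exp ℂ).subst stirlingExponent : ℂ⟦X⟧)

/-- `(2m - 1)!!` for every integer `m`: the usual double factorial for `m ≥ 0` (with
`(-1)!! = 1`), and `(-2j - 1)!! = (-1)^j / (2j - 1)!!` for `j ≥ 1`. -/
def oddDoubleFactorial : ℤ → ℂ
  | Int.ofNat m => ((2 * m - 1)‼ : ℕ)
  | Int.negSucc j => (-1) ^ (j + 1) / ((2 * j + 1)‼ : ℕ)

/-- The extended double factorial is the one given by `(2m + 1)!! = (2m + 1) (2m - 1)!!` and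
`1!! = 1`. -/
theorem oddDoubleFactorial_add_one (m : ℤ) :
    oddDoubleFactorial (m + 1) = (2 * m + 1) * oddDoubleFactorial m := by
  rcases m with m | j
  · change (((2 * (m + 1) - 1)‼ : ℕ) : ℂ) = (2 * ((m : ℤ) : ℂ) + 1) * (((2 * m - 1)‼ : ℕ) : ℂ)
    rw [show 2 * (m + 1) - 1 = 2 * m + 1 by omega, Nat.doubleFactorial_add_one]
    push_cast
    ring
  · rcases j with _ | j
    · change ((((2 * 0 - 1)‼ : ℕ)) : ℂ) = (2 * ((Int.negSucc 0 : ℤ) : ℂ) + 1) *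
        ((-1) ^ (0 + 1) / (((2 * 0 + 1)‼ : ℕ) : ℂ))
      norm_num [Nat.doubleFactorial]
    · change (-1 : ℂ) ^ (j + 1) / (((2 * j + 1)‼ : ℕ) : ℂ) =
        (2 * ((Int.negSucc (j + 1) : ℤ) : ℂ) + 1) *
          ((-1) ^ (j + 1 + 1) / (((2 * (j + 1) + 1)‼ : ℕ) : ℂ))
      rw [show 2 * (j + 1) + 1 = (2 * j + 1) + 2 by ring, Nat.doubleFactorial_add_two]
      have h1 : (((2 * j + 1)‼ : ℕ) : ℂ) ≠ 0 := by
        exact_mod_cast (Nat.doubleFactorial_pos _).ne'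
      have h2 : ((2 * j + 1 + 2 : ℕ) : ℂ) ≠ 0 := Nat.cast_ne_zero.mpr (by omega)
      rw [Int.cast_negSucc]
      push_cast at h2 ⊢
      field_simp
      ring

/-- The even power series `∑_{k ≥ 0} c_k v^{2k}`. -/
def evenSeries (c : ℕ → ℂ) : ℂ⟦X⟧ := PowerSeries.mk fun j => if Even j then c (j / 2) else 0

/-- `η_n(v) = (1/v) ∑_{k ≥ 0} s_k (2(n-k)-1)!! / v^{2(n-k)}`, as a Laurent series in `v`. -/
def eta (n : ℤ) : ℂ⸨X⸩ :=
  HahnSeries.single (-2 * n - 1) 1 *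
    HahnSeries.ofPowerSeries ℤ ℂ
      (evenSeries fun k => stirlingCoeff k * oddDoubleFactorial (n - k))

/-- `∑_{k ≥ 1} (-1)^{k-1} s_k / (2k+1)!! v^{2k}`. -/
def etaTail : ℂ⟦X⟧ :=
  evenSeries fun k =>
    if k = 0 then 0 else (-1) ^ (k - 1) * stirlingCoeff k / ((2 * k + 1)‼ : ℕ)

/-- `-(1/v) (1 + ∑_{m ≥ 1} T^m)` with `T` the series `etaTail`. -/
def etaReciprocal : ℂ⸨X⸩ :=
  -(HahnSeries.single (-1) 1 *
    HahnSeries.ofPowerSeries ℤ ℂ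
      (1 + (PowerSeries.mk fun m => if m = 0 then 0 else 1 : ℂ⟦X⟧).subst etaTail))

/-- The substitution `f(v)|_{v = v(t)}` of `v(t)` into a Laurent series `f` in `v`; the result is
a Laurent series in `t⁻¹`. -/
def atV (f : ℂ⸨X⸩) : ℂ⸨X⸩ :=
  HahnSeries.ofPowerSeries ℤ ℂ v ^ f.order *
    HahnSeries.ofPowerSeries ℤ ℂ (f.powerSeriesPart.subst v)

/-- The coefficient of `dt` in `f(v) dv|_{v = v(t)}`. -/
def pullbackForm (f : ℂ⸨X⸩) : ℂ⸨X⸩ := atV f * ddt (HahnSeries.ofPowerSeries ℤ ℂ v)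

end Lambert

end

noncomputable section

namespace Lambert

open PowerSeries Finset

/-! The proof rests on the derivation D = t²(t-1) d/dt = -d/dw = -v⁻¹ d/dv and on parity in v. Since
w takes the same value at s and t, passing from t to s is v ↦ -v, and D ξ̂_n = ξ̂_{n+1} holds at s
as well as at t. The recursion of the odd double factorials gives D η_n = η_{n+1}. So η_n is the odd
part of ξ̂_n for every n ≥ 0 (`atV_eta`) as soon as 1/s - 1/t = 2η_{-1} (`atV_eta_neg_one`), while
the even part is a power series in v² (`exists_aeval_xiHat_add`).

In the residue, ts/(t-s) = 1/(2η_{-1}) and dt/(t²(t-1)) = -v dv (`residue_kernel`). The symmetrized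
product is twice (even·even - odd·odd): the odd parts give the claim, and the even parts contribute
O(t⁻²) dt, which [·]_+ kills.

The remaining input is that the odd coefficients of the inverse series 1/t = τ(v) are Stirling
coefficients (`doubleFactorial_mul_coeff_tau`). This is Stirling's expansion of Γ, done formally
with L(g) = ∫ g(z) e^{-w(z)/y} dz, z = 1/t. Integration by parts gives L((1-z)^k) = ∏_{j≤k} (1+jy) ·
L(1). The coefficients in y are polynomials in k; their derivatives at k = 0 express L(log(1-z)) by
Bernoulli numbers, which yields a differential equation in y that determines L(1) (`laplace_one`).
-/

/-! ### Formal Gaussian integration -/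

/-- The formal Gaussian integral `v^{2k} ↦ (2k-1)!! y^k`, `v^{2k+1} ↦ 0`. -/
def gaussMoment : ℂ⟦X⟧ →ₗ[ℂ] ℂ⟦X⟧ where
  -- At k = 0 truncated subtraction gives 0‼ = 1, the intended value of (-1)!!.
  toFun g := PowerSeries.mk fun k => ((2 * k - 1)‼ : ℕ) * coeff (2 * k) g
  map_add' f g := by ext; simp [mul_add]
  map_smul' c f := by ext; simp; ring

lemma coeff_gaussMoment (g : ℂ⟦X⟧) (k : ℕ) :
    coeff k (gaussMoment g) = ((2 * k - 1)‼ : ℕ) * coeff (2 * k) g := by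
  simp [gaussMoment]

lemma doubleFactorial_two_mul_add_one (k : ℕ) :
    (((2 * k + 1)‼ : ℕ) : ℂ) = (2 * k + 1) * ((2 * k - 1)‼ : ℕ) := by
  rw [Nat.doubleFactorial_add_one]; push_cast; ring

/-- Integration by parts against e^{-v²/(2y)}. -/
lemma gaussMoment_X_mul (g : ℂ⟦X⟧) :
    gaussMoment (X * g) = X * gaussMoment (d⁄dX ℂ g) := by
  ext n
  rcases n with _ | k
  · simp [coeff_gaussMoment]
  · rw [coeff_succ_X_mul, coeff_gaussMoment, coeff_gaussMoment, coeff_derivative,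
      show 2 * (k + 1) = (2 * k + 1) + 1 by ring, coeff_succ_X_mul,
      show 2 * k + 1 + 1 - 1 = 2 * k + 1 by omega, doubleFactorial_two_mul_add_one]
    push_cast
    ring

/-- Differentiation of (2πy)^{-1/2} ∫ g e^{-v²/(2y)} dv in y: the exponent contributes v²/2, the
normalization -y/2. -/
lemma X_sq_mul_derivative_gaussMoment (g : ℂ⟦X⟧) :
    X ^ 2 * d⁄dX ℂ (gaussMoment g) =
      gaussMoment (C (1 / 2 : ℂ) * X ^ 2 * g) - C (1 / 2 : ℂ) * X * gaussMoment g := by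
  ext n
  rw [map_sub, coeff_gaussMoment, mul_assoc, coeff_C_mul, mul_assoc, coeff_C_mul]
  rcases n with _ | k
  · simp
  · rw [coeff_succ_X_mul, show 2 * (k + 1) = 2 * k + 2 by ring, coeff_X_pow_mul,
      show 2 * k + 2 - 1 = 2 * k + 1 by omega, doubleFactorial_two_mul_add_one,
      coeff_gaussMoment]
    rcases k with _ | k
    · rw [show (0 : ℕ) + 1 = 1 from rfl, coeff_X_pow_mul', if_neg (by norm_num)]
      simp
    · rw [show k + 1 + 1 = k + 2 by ring, coeff_X_pow_mul, coeff_derivative, coeff_gaussMoment]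
      push_cast
      ring

lemma coeff_gaussMoment_eq_zero {g : ℂ⟦X⟧} {m n : ℕ} (h : X ^ m ∣ g) (hn : 2 * n < m) :
    coeff n (gaussMoment g) = 0 := by
  rw [coeff_gaussMoment, X_pow_dvd_iff.mp h _ hn, mul_zero]

/-! ### The inverse series of `v` -/

lemma hasSubst_v : HasSubst v := HasSubst.of_constantCoeff_zero' v_spec.1

lemma isUnit_coeff_one_v : IsUnit (coeff 1 v) := by rw [v_spec.2.1]; exact isUnit_one

/-- `1/t` as a power series in `v`. -/
def tau : ℂ⟦X⟧ := substInvOfIsUnit v isUnit_coeff_one_v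

lemma constantCoeff_tau : constantCoeff tau = 0 := constantCoeff_substInvOfIsUnit ..

lemma hasSubst_tau : HasSubst tau := HasSubst.of_constantCoeff_zero' constantCoeff_tau

lemma v_subst_tau : v.subst tau = (X : ℂ⟦X⟧) :=
  subst_substInvOfIsUnit_right (P := v) v_spec.1 isUnit_coeff_one_v

lemma tau_subst_v : tau.subst v = (X : ℂ⟦X⟧) :=
  subst_substInvOfIsUnit_left (P := v) v_spec.1 isUnit_coeff_one_v

lemma coeff_one_tau : coeff 1 tau = 1 := by
  have h := coeff_one_substInvOfIsUnit v isUnit_coeff_one_v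
  have h2 : ((isUnit_coeff_one_v.unit⁻¹ : ℂˣ) : ℂ) = 1 := by
    rw [Units.val_inv_eq_inv_val, IsUnit.unit_spec, v_spec.2.1, inv_one]
  exact h.trans h2

lemma subst_C_mul {a : ℂ⟦X⟧} (ha : HasSubst a) (c : ℂ) (f : ℂ⟦X⟧) :
    ((C c * f).subst a : ℂ⟦X⟧) = C c * f.subst a := by
  rw [subst_mul ha]; congr 1; exact subst_C _

lemma subst_one {a : ℂ⟦X⟧} (ha : HasSubst a) : ((1 : ℂ⟦X⟧).subst a : ℂ⟦X⟧) = 1 := by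
  rw [← coe_substAlgHom ha, map_one]

lemma w_subst_tau : w.subst tau = C (1 / 2 : ℂ) * (X : ℂ⟦X⟧) ^ 2 := by
  rw [← v_spec.2.2, subst_C_mul hasSubst_tau, subst_pow hasSubst_tau, v_subst_tau]

lemma one_sub_X_mul_derivative_w : (1 - X) * d⁄dX ℂ w = X := by
  rw [sub_mul, one_mul]
  ext n
  rw [map_sub, coeff_derivative, coeff_X]
  rcases n with _ | k
  · simp [w]
  · rw [coeff_succ_X_mul, coeff_derivative, w, coeff_mk, coeff_mk, if_pos (by omega)]
    have h1 : ((k : ℂ) + 1) ≠ 0 := Nat.cast_add_one_ne_zero k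
    have h2 : ((k : ℂ) + 1 + 1) ≠ 0 := by exact_mod_cast (Nat.succ_ne_zero (k + 1))
    push_cast
    rw [one_div, inv_mul_cancel₀ h2]
    rcases k with _ | k
    · simp
    · rw [if_pos (by omega), if_neg (by omega)]
      push_cast at h1 ⊢
      rw [one_div, inv_mul_cancel₀ h1, sub_self]

/-- The derivative of w(τ(v)) = v²/2, with w'(z) = z/(1-z). -/
lemma tau_mul_derivative_tau : tau * d⁄dX ℂ tau = X * (1 - tau) := by
  have h1 : (d⁄dX ℂ w).subst tau * d⁄dX ℂ tau = (X : ℂ⟦X⟧) := by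
    rw [← derivative_subst hasSubst_tau, w_subst_tau, Derivation.leibniz, derivative_C,
      derivative_pow, derivative_X]
    have : (C (1 / 2 : ℂ)) * (2 : ℂ⟦X⟧) = 1 := by
      rw [show (2 : ℂ⟦X⟧) = C 2 from (map_ofNat C 2).symm, ← map_mul]; norm_num
    simp only [smul_eq_mul, mul_zero, add_zero]
    push_cast
    linear_combination X * this
  have h2 := congrArg (fun f => f.subst tau) one_sub_X_mul_derivative_w
  simp only [subst_mul hasSubst_tau, subst_sub hasSubst_tau, subst_one hasSubst_tau,
    subst_X hasSubst_tau] at h2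
  linear_combination (-d⁄dX ℂ tau) * h2 + (1 - tau) * h1

/-! ### The formal Laplace integral -/

/-- The formal integral `∫ g(z) e^{-w(z)/y} dz`, normalized by its leading factor. -/
def laplace : ℂ⟦X⟧ →ₗ[ℂ] ℂ⟦X⟧ where
  toFun g := gaussMoment (g.subst tau * d⁄dX ℂ tau)
  map_add' f g := by rw [subst_add hasSubst_tau, add_mul, map_add]
  map_smul' c f := by rw [subst_smul hasSubst_tau, smul_mul_assoc, map_smul, RingHom.id_apply]

lemma laplace_apply (g : ℂ⟦X⟧) : laplace g = gaussMoment (g.subst tau * d⁄dX ℂ tau) := rfl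

/-- Integration by parts: z p dz = (1-z) p dw, and dw = v dv. -/
lemma laplace_X_mul (p : ℂ⟦X⟧) :
    laplace (X * p) = X * laplace (d⁄dX ℂ ((1 - X) * p)) := by
  rw [laplace_apply, laplace_apply, ← derivative_subst hasSubst_tau, ← gaussMoment_X_mul]
  congr 1
  simp only [subst_mul hasSubst_tau, subst_sub hasSubst_tau, subst_one hasSubst_tau,
    subst_X hasSubst_tau]
  linear_combination (p.subst tau : ℂ⟦X⟧) * tau_mul_derivative_tau

/-- `∏_{j=1}^k (1 + j y)`. -/
def risingProduct (k : ℕ) : ℂ⟦X⟧ := ∏ j ∈ range k, (1 + C ((j : ℂ) + 1) * X)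

/-- Formal counterpart of the functional equation of Γ: each factor comes from one integration by
parts. -/
lemma laplace_one_sub_X_pow (k : ℕ) :
    laplace ((1 - X) ^ k) = risingProduct k * laplace 1 := by
  induction k with
  | zero => simp [risingProduct]
  | succ k ih =>
    have h := laplace_X_mul ((1 - X) ^ k)
    rw [← pow_succ', derivative_pow, map_sub, derivative_X, derivative_one] at h
    have e : ((k + 1 : ℕ) : ℂ⟦X⟧) * (1 - X) ^ (k + 1 - 1) * (0 - 1) =
        -((k : ℂ) + 1) • (1 - X) ^ k := by
      rw [smul_eq_C_mul, Nat.add_sub_cancel]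
      push_cast [map_neg, map_add, map_one, map_natCast]
      ring
    rw [e, map_smul, smul_eq_C_mul] at h
    have e2 : ((1 : ℂ⟦X⟧) - X) ^ (k + 1) = (1 - X) ^ k - X * (1 - X) ^ k := by ring
    rw [e2, map_sub, h, ih, risingProduct, risingProduct, prod_range_succ, map_neg]
    ring

lemma X_sq_mul_derivative_laplace_one :
    X ^ 2 * d⁄dX ℂ (laplace 1) = laplace w - C (1 / 2 : ℂ) * X * laplace 1 := by
  rw [laplace_apply, X_sq_mul_derivative_gaussMoment, laplace_apply, w_subst_tau,
    subst_one hasSubst_tau, one_mul]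

lemma coeff_laplace_X_pow_mul_eq_zero (g : ℂ⟦X⟧) {m n : ℕ} (hn : 2 * n < m) :
    coeff n (laplace (X ^ m * g)) = 0 := by
  refine coeff_gaussMoment_eq_zero (m := m) ?_ hn
  rw [subst_mul hasSubst_tau, subst_pow hasSubst_tau, subst_X hasSubst_tau, mul_assoc]
  exact Dvd.dvd.mul_right (pow_dvd_pow_of_dvd (X_dvd_iff.mpr constantCoeff_tau) _) _

/-- Makes `laplace` computable term by term: z^m g contributes nothing to yⁿ once m > 2n, so a
finite sum suffices. -/
lemma coeff_laplace (g : ℂ⟦X⟧) (n : ℕ) :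
    coeff n (laplace g) =
      ∑ j ∈ range (2 * n + 1), coeff j g * coeff n (laplace (X ^ j)) := by
  have h : g = X ^ (2 * n + 1) * PowerSeries.mk (fun i => coeff (i + (2 * n + 1)) g) +
      ∑ j ∈ range (2 * n + 1), coeff j g • X ^ j := by
    conv_lhs => rw [g.eq_X_pow_mul_shift_add_trunc (2 * n + 1)]
    congr 1
    rw [trunc_apply]
    ext i
    simp [Nat.Ico_zero_eq_range, Polynomial.coeff_monomial, coeff_X_pow, eq_comm]
  conv_lhs => rw [h]
  rw [map_add, map_add, coeff_laplace_X_pow_mul_eq_zero _ (by omega), zero_add, map_sum, map_sum]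
  refine sum_congr rfl fun j _ => ?_
  rw [map_smul, map_smul, smul_eq_mul]

/-! ### Interpolation in k and derivatives at k = 0 -/

lemma exists_powerSum_polynomial (m : ℕ) : ∃ S : Polynomial ℂ,
    (∀ k : ℕ, S.eval (k : ℂ) = ∑ j ∈ range k, ((j : ℂ) + 1) ^ (m + 1)) ∧
      (Polynomial.derivative S).eval 0 = (bernoulli' (m + 1) : ℂ) := by
  have hm : ((m + 1 : ℕ) : ℚ) + 1 ≠ 0 := Nat.cast_add_one_ne_zero _
  -- Faulhaber's polynomial, shifted by 1 because the bases run over 1, …, k.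
  refine ⟨Polynomial.map (algebraMap ℚ ℂ) (Polynomial.C (1 / (((m + 1 : ℕ) : ℚ) + 1)) *
    ((Polynomial.bernoulli (m + 2)).comp (Polynomial.X + 1) -
      Polynomial.C (bernoulli (m + 2)))), fun k => ?_, ?_⟩
  · have h := Polynomial.sum_range_pow_eq_bernoulli_sub (k + 1) (m + 1)
    rw [sum_range_succ'] at h
    have e : Polynomial.eval (k : ℚ) (Polynomial.C (1 / (((m + 1 : ℕ) : ℚ) + 1)) *
        ((Polynomial.bernoulli (m + 2)).comp (Polynomial.X + 1) -
        Polynomial.C (bernoulli (m + 2)))) = ∑ j ∈ range k, ((j : ℚ) + 1) ^ (m + 1) := by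
      simp only [Polynomial.eval_mul, Polynomial.eval_C, Polynomial.eval_sub,
        Polynomial.eval_comp, Polynomial.eval_add, Polynomial.eval_X, Polynomial.eval_one]
      push_cast at h hm ⊢
      rw [← h]
      field_simp
      simp
    have e2 := congrArg (algebraMap ℚ ℂ) e
    rw [← Polynomial.eval₂_at_apply, ← Polynomial.eval_map] at e2
    simpa using e2
  · rw [Polynomial.derivative_map]
    have e : Polynomial.eval 0 (Polynomial.derivative (Polynomial.C (1 / (((m + 1 : ℕ) : ℚ) + 1)) *
        ((Polynomial.bernoulli (m + 2)).comp (Polynomial.X + 1) -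
        Polynomial.C (bernoulli (m + 2))))) = bernoulli' (m + 1) := by
      rw [Polynomial.derivative_C_mul, Polynomial.derivative_sub, Polynomial.derivative_C,
        sub_zero, Polynomial.derivative_comp, Polynomial.derivative_bernoulli_add_one]
      simp only [Polynomial.eval_mul, Polynomial.eval_C, Polynomial.eval_comp,
        Polynomial.eval_add, Polynomial.eval_X, Polynomial.eval_one, zero_add,
        Polynomial.bernoulli_eval_one, Polynomial.derivative_add, Polynomial.derivative_X,
        Polynomial.derivative_one, Polynomial.eval_natCast, Polynomial.mul_comp]
      simp
      field_simp
    have e2 := congrArg (algebraMap ℚ ℂ) e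
    rw [← Polynomial.eval₂_at_apply, ← Polynomial.eval_map] at e2
    simpa using e2

/-- The logarithmic derivative of `risingProduct k`, multiplied by `y`. -/
def powerSumSeries (k : ℕ) : ℂ⟦X⟧ := ∑ j ∈ range k,
  PowerSeries.mk fun n => if n = 0 then 0 else (-1) ^ (n - 1) * ((j : ℂ) + 1) ^ n

lemma X_mul_derivative_risingProduct (k : ℕ) :
    X * d⁄dX ℂ (risingProduct k) = powerSumSeries k * risingProduct k := by
  induction k with
  | zero => simp [risingProduct, powerSumSeries]
  | succ k ih =>
    have e : (1 + C ((k : ℂ) + 1) * X) * (PowerSeries.mk fun n =>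
        if n = 0 then 0 else (-1) ^ (n - 1) * ((k : ℂ) + 1) ^ n) = C ((k : ℂ) + 1) * X := by
      ext n
      rw [add_mul, one_mul, mul_assoc, map_add, coeff_C_mul, coeff_C_mul]
      rcases n with _ | _ | n
      · simp
      · rw [coeff_succ_X_mul]; simp
      · rw [coeff_succ_X_mul, coeff_X, if_neg (by omega)]
        simp
        ring
    have e1 : risingProduct (k + 1) = risingProduct k * (1 + C ((k : ℂ) + 1) * X) := by
      rw [risingProduct, prod_range_succ, risingProduct]
    have e2 : powerSumSeries (k + 1) = powerSumSeries k + PowerSeries.mk fun n =>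
        if n = 0 then 0 else (-1) ^ (n - 1) * ((k : ℂ) + 1) ^ n := by
      rw [powerSumSeries, sum_range_succ, powerSumSeries]
    rw [e1, e2, Derivation.leibniz, map_add, derivative_one, Derivation.leibniz, derivative_C,
      derivative_X]
    simp only [smul_eq_mul, mul_zero, add_zero, zero_add, mul_one]
    linear_combination (1 + C ((k : ℂ) + 1) * X) * ih - risingProduct k * e

lemma exists_risingProduct_polynomial (n : ℕ) : ∃ q : Polynomial ℂ,
    (∀ k : ℕ, q.eval (k : ℂ) = coeff n (risingProduct k)) ∧
      (Polynomial.derivative q).eval 0 = -((bernoulli n : ℂ) / n) := by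
  induction n using Nat.strong_induction_on with
  | _ n ih =>
  rcases n with _ | n
  -- For n = 0 the quotient by zero is 0, the derivative of the constant 1.
  · refine ⟨1, fun k => ?_, by simp⟩
    simp [risingProduct, map_prod]
  choose! q hq hq' using ih
  choose S hS hS' using exists_powerSum_polynomial
  have hn : (n : ℂ) + 1 ≠ 0 := Nat.cast_add_one_ne_zero n
  have hps : ∀ i k : ℕ, coeff (i + 1) (powerSumSeries k) = (-1) ^ i * (S i).eval (k : ℂ) := by
    intro i k
    rw [hS, powerSumSeries, map_sum, mul_sum]
    simp
  have hps0 : ∀ k : ℕ, coeff 0 (powerSumSeries k) = 0 := by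
    intro k
    rw [powerSumSeries, map_sum]
    simp
  -- The recursion read off from the coefficient of y^{n+1} in the logarithmic derivative equation.
  refine ⟨Polynomial.C (1 / ((n : ℂ) + 1)) *
    ∑ p ∈ antidiagonal n, Polynomial.C ((-1) ^ p.1) * S p.1 * q p.2, fun k => ?_, ?_⟩
  · have h := congrArg (coeff (n + 1)) (X_mul_derivative_risingProduct k)
    rw [coeff_succ_X_mul, coeff_derivative, coeff_mul, Nat.sum_antidiagonal_succ, hps0, zero_mul,
      zero_add] at h
    rw [Polynomial.eval_mul, Polynomial.eval_C, Polynomial.eval_finsetSum]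
    have e : ∑ p ∈ antidiagonal n,
        Polynomial.eval (k : ℂ) (Polynomial.C ((-1) ^ p.1) * S p.1 * q p.2) =
        coeff (n + 1) (risingProduct k) * ((n : ℂ) + 1) := by
      rw [h]
      refine sum_congr rfl fun p hp => ?_
      rw [HasAntidiagonal.mem_antidiagonal] at hp
      rw [Polynomial.eval_mul, Polynomial.eval_mul, Polynomial.eval_C, hq _ (by omega), hps]
    rw [e]
    field_simp
  · rw [Polynomial.derivative_C_mul, Polynomial.eval_mul, Polynomial.eval_C,
      Polynomial.derivative_sum, Polynomial.eval_finsetSum]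
    have hS0 : ∀ i, (S i).eval 0 = 0 := fun i => by
      have := hS i 0
      simpa using this
    have hq0 : ∀ i < n + 1, (q i).eval 0 = if i = 0 then 1 else 0 := fun i hi => by
      have := hq i hi 0
      simpa [risingProduct, coeff_one] using this
    -- All S_i vanish at 0, and so do all q_j with j > 0; only S_n' q_0 survives the product rule.
    have e : ∀ p ∈ antidiagonal n,
        Polynomial.eval 0 (Polynomial.derivative (Polynomial.C ((-1) ^ p.1) * S p.1 * q p.2)) =
        if p = (n, 0) then (-1) ^ n * (bernoulli' (n + 1) : ℂ) else 0 := by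
      rintro ⟨i, j⟩ hp
      rw [HasAntidiagonal.mem_antidiagonal] at hp
      simp only at hp ⊢
      rw [mul_assoc, Polynomial.derivative_C_mul, Polynomial.derivative_mul, Polynomial.eval_mul,
        Polynomial.eval_add, Polynomial.eval_mul, Polynomial.eval_mul, Polynomial.eval_C,
        hS0, hS', hq0 j (by omega)]
      by_cases hj : j = 0
      · obtain rfl : i = n := by omega
        simp [hj]
      · simp [hj]
    rw [sum_congr rfl e, sum_ite_eq' (antidiagonal n) (n, 0), if_pos (by simp),
      bernoulli'_eq_bernoulli]
    push_cast
    have hsign : (-1 : ℂ) ^ n * (-1) ^ (n + 1) = -1 := by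
      rw [← pow_add, show n + (n + 1) = 2 * n + 1 by ring, pow_succ, pow_mul]
      norm_num
    linear_combination (bernoulli (n + 1) : ℂ) / ((n : ℂ) + 1) * hsign

lemma exists_choose_polynomial (j : ℕ) : ∃ b : Polynomial ℂ,
    (∀ k : ℕ, b.eval (k : ℂ) = (k.choose j : ℂ)) ∧
      (Polynomial.derivative b).eval 0 = -((-1) ^ j / (j : ℂ)) := by
  have hf : ∀ i : ℕ, ((i ! : ℕ) : ℂ) ≠ 0 := fun i => by exact_mod_cast i.factorial_ne_zero
  refine ⟨Polynomial.C (1 / ((j ! : ℕ) : ℂ)) * descPochhammer ℂ j, fun k => ?_, ?_⟩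
  · rw [Polynomial.eval_mul, Polynomial.eval_C, descPochhammer_eval_eq_descFactorial,
      Nat.descFactorial_eq_factorial_mul_choose]
    push_cast
    field_simp [hf j]
  · rcases j with _ | i
    · simp
    -- The falling factorial is x times its shift, so its derivative at 0 is the shorter falling
    -- factorial at -1.
    · have hd : (descPochhammer ℂ i).eval (-1) = (-1) ^ i * ((i ! : ℕ) : ℂ) := by
        rw [descPochhammer_eval_eq_prod_range]
        induction i with
        | zero => simp
        | succ i ih => rw [prod_range_succ, ih, Nat.factorial_succ]; push_cast; ring
      rw [Polynomial.derivative_C_mul, descPochhammer_succ_left, Polynomial.derivative_mul]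
      simp only [Polynomial.eval_mul, Polynomial.eval_C, Polynomial.eval_add, Polynomial.eval_X,
        Polynomial.derivative_X, Polynomial.eval_one, Polynomial.eval_comp, Polynomial.eval_sub,
        zero_mul, add_zero, one_mul, zero_sub, hd, Nat.factorial_succ]
      have h1 := hf i
      have h2 : (i : ℂ) + 1 ≠ 0 := Nat.cast_add_one_ne_zero i
      push_cast
      field_simp
      ring

lemma polynomial_eq_of_eval_natCast {p q : Polynomial ℂ}
    (h : ∀ k : ℕ, p.eval (k : ℂ) = q.eval (k : ℂ)) : p = q := by
  refine Polynomial.eq_of_infinite_eval_eq p q ?_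
  refine Set.Infinite.mono ?_ (Set.infinite_range_of_injective (Nat.cast_injective (R := ℂ)))
  rintro _ ⟨k, rfl⟩
  exact h k

lemma coeff_one_sub_X_pow (k j : ℕ) :
    coeff j ((1 - X : ℂ⟦X⟧) ^ k) = (-1) ^ j * (k.choose j : ℂ) := by
  have h : ((1 - X : ℂ⟦X⟧)) ^ k =
      rescale (-1) (((1 + Polynomial.X : Polynomial ℂ) ^ k : Polynomial ℂ) : ℂ⟦X⟧) := by
    simp [sub_eq_add_neg]
  rw [h, coeff_rescale, Polynomial.coeff_coe, Polynomial.coeff_one_add_X_pow]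

/-! ### The Stirling series as L(1) -/

/-- The integral of `log (1 - z)`: the asymptotic expansion of the digamma function. -/
lemma sum_coeff_laplace_X_pow (n : ℕ) :
    ∑ j ∈ range (2 * n + 1), (1 / (j : ℂ)) * coeff n (laplace (X ^ j)) =
      coeff n (laplace 1 * PowerSeries.mk fun i => (bernoulli i : ℂ) / i) := by
  choose b hb hb' using exists_choose_polynomial
  choose q hq hq' using exists_risingProduct_polynomial
  -- The formula for L((1-z)^k) at yⁿ, valid for all natural k, becomes a polynomial identity that
  -- can be differentiated at 0.
  have key : ∑ j ∈ range (2 * n + 1),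
      Polynomial.C ((-1) ^ j * coeff n (laplace (X ^ j))) * b j =
      ∑ p ∈ antidiagonal n, Polynomial.C (coeff p.1 (laplace 1)) * q p.2 := by
    refine polynomial_eq_of_eval_natCast fun k => ?_
    have h := congrArg (coeff n) (laplace_one_sub_X_pow k)
    rw [coeff_laplace, mul_comm (risingProduct k), coeff_mul] at h
    simp only [Polynomial.eval_finsetSum, Polynomial.eval_mul, Polynomial.eval_C, hb, hq]
    rw [← h]
    refine sum_congr rfl fun j _ => ?_
    rw [coeff_one_sub_X_pow]
    ring
  have key' := congrArg (fun p => (Polynomial.derivative p).eval 0) key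
  simp only [Polynomial.derivative_sum, Polynomial.derivative_C_mul, Polynomial.eval_finsetSum,
    Polynomial.eval_mul, Polynomial.eval_C, hb', hq'] at key'
  rw [coeff_mul]
  simp only [coeff_mk]
  rw [← neg_inj, ← sum_neg_distrib, ← sum_neg_distrib]
  refine Eq.trans (sum_congr rfl fun j _ => ?_) (key'.trans (sum_congr rfl fun p _ => ?_))
  · have : ((-1 : ℂ) ^ j) * (-1) ^ j = 1 := by rw [← mul_pow]; simp
    linear_combination (1 / (j : ℂ)) * coeff n (laplace (X ^ j)) * this
  · ring

/-- Uses w = -log(1-z) - z and L(z) = -y L(1). -/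
lemma laplace_w : laplace w =
    laplace 1 * (PowerSeries.mk fun i => (bernoulli i : ℂ) / i) + X * laplace 1 := by
  have hX : laplace X = -(X * laplace 1) := by
    have h := laplace_one_sub_X_pow 1
    rw [pow_one, map_sub, risingProduct] at h
    simp at h
    linear_combination -h
  ext n
  have hX' : coeff n (laplace X) =
      ∑ j ∈ range (2 * n + 1), coeff j (X : ℂ⟦X⟧) * coeff n (laplace (X ^ j)) :=
    coeff_laplace _ _
  rw [map_add, ← sum_coeff_laplace_X_pow, ← neg_neg (X * laplace 1), ← hX, map_neg, hX',
    coeff_laplace, ← sub_eq_add_neg, ← sum_sub_distrib]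
  refine sum_congr rfl fun j _ => ?_
  rw [← sub_mul, w, coeff_mk, coeff_X]
  rcases j with _ | _ | j <;> simp

lemma derivative_laplace_one :
    d⁄dX ℂ (laplace 1) = -d⁄dX ℂ stirlingExponent * laplace 1 := by
  have h := X_sq_mul_derivative_laplace_one
  -- B_1 = -1/2 is the separate linear term; the other odd Bernoulli numbers vanish. The linear
  -- terms then cancel in the differential equation.
  have e : (PowerSeries.mk fun i => (bernoulli i : ℂ) / i) =
      -(X ^ 2 * d⁄dX ℂ stirlingExponent) - C (1 / 2 : ℂ) * X := by
    ext n
    rw [map_sub, map_neg, coeff_C_mul, coeff_mk, coeff_X]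
    rcases n with _ | _ | n
    · simp
    · rw [show 0 + 1 = 1 from rfl, coeff_X_pow_mul', if_neg (by norm_num)]
      norm_num
    · rw [show n + 1 + 1 = n + 2 by ring, coeff_X_pow_mul, coeff_derivative, stirlingExponent,
        coeff_mk, if_neg (show ¬n + 2 = 1 by omega)]
      have h1 : (n : ℂ) + 1 ≠ 0 := Nat.cast_add_one_ne_zero n
      have h2 : (n : ℂ) + 1 + 1 ≠ 0 := by exact_mod_cast (Nat.succ_ne_zero (n + 1))
      have h3 : (n : ℂ) + 2 ≠ 0 := by exact_mod_cast (Nat.succ_ne_zero (n + 1))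
      split_ifs with hodd
      · push_cast
        rw [show n + 1 + 1 = n + 2 by ring]
        field_simp
        ring
      · rw [bernoulli_eq_zero_of_odd (by
          rw [Nat.odd_add_one, not_not] at hodd
          rw [Nat.odd_iff] at hodd ⊢
          omega) (by omega)]
        simp
  rw [laplace_w, e] at h
  have hh : C (1 / 2 : ℂ) + C (1 / 2 : ℂ) = (1 : ℂ⟦X⟧) := by rw [← map_add]; norm_num
  refine mul_left_cancel₀ (pow_ne_zero 2 X_ne_zero) (h.trans ?_)
  linear_combination (-X * laplace 1) * hh

/-- The Stirling series `∑ s_k y^k`. -/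
def stirlingSeries : ℂ⟦X⟧ := (PowerSeries.exp ℂ).subst stirlingExponent

lemma coeff_stirlingSeries (k : ℕ) : coeff k stirlingSeries = stirlingCoeff k := rfl

lemma constantCoeff_stirlingExponent : constantCoeff stirlingExponent = 0 := by
  rw [← coeff_zero_eq_constantCoeff_apply, stirlingExponent, coeff_mk]; simp

lemma derivative_stirlingSeries :
    d⁄dX ℂ stirlingSeries = d⁄dX ℂ stirlingExponent * stirlingSeries := by
  rw [stirlingSeries, derivative_subst
    (HasSubst.of_constantCoeff_zero' constantCoeff_stirlingExponent), derivative_exp, mul_comm]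

lemma stirlingCoeff_zero : stirlingCoeff 0 = 1 := by
  have hs := HasSubst.of_constantCoeff_zero' constantCoeff_stirlingExponent
  have h0 : constantCoeff (PowerSeries.exp ℂ - 1) = 0 := by simp
  have h1 := constantCoeff_subst_eq_zero constantCoeff_stirlingExponent _ h0
  rw [subst_sub hs, subst_one hs] at h1
  have h2 : constantCoeff ((PowerSeries.exp ℂ).subst stirlingExponent - 1 : ℂ⟦X⟧) = 0 := h1
  rw [map_sub, sub_eq_zero] at h2
  simpa [stirlingCoeff] using h2

lemma derivative_rescale_neg_one (f : ℂ⟦X⟧) :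
    d⁄dX ℂ (rescale (-1) f) = -rescale (-1) (d⁄dX ℂ f) := by
  ext n
  rw [map_neg, coeff_derivative, coeff_rescale, coeff_rescale, coeff_derivative]
  ring

lemma rescale_neg_one_derivative_stirlingExponent :
    rescale (-1) (d⁄dX ℂ stirlingExponent) = d⁄dX ℂ stirlingExponent := by
  ext n
  rw [coeff_rescale, coeff_derivative, stirlingExponent, coeff_mk]
  split_ifs with h
  · rw [Even.neg_one_pow (by rw [Nat.odd_add_one, Nat.not_odd_iff_even] at h; exact h), one_mul]
  · simp

/-- Both sides are inverse to the Stirling series: the products have derivative 0 and constant term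
1. For the right side this uses that the exponent is odd. -/
lemma laplace_one : laplace 1 = rescale (-1) stirlingSeries := by
  have hA0 : constantCoeff (laplace 1) = 1 := by
    rw [← coeff_zero_eq_constantCoeff_apply, laplace_apply, coeff_gaussMoment, subst_one hasSubst_tau,
      one_mul, mul_zero, coeff_derivative, zero_add, coeff_one_tau]
    simp
  have hS0 : constantCoeff stirlingSeries = 1 := by
    rw [← coeff_zero_eq_constantCoeff_apply, coeff_stirlingSeries, stirlingCoeff_zero]
  have hT0 : constantCoeff (rescale (-1) stirlingSeries) = 1 := by
    rw [← coeff_zero_eq_constantCoeff_apply, coeff_rescale, coeff_zero_eq_constantCoeff_apply, hS0]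
    simp
  have hne : stirlingSeries ≠ 0 := fun h => by simp [h] at hS0
  have h1 : laplace 1 * stirlingSeries = 1 := by
    refine derivative.ext (R := ℂ) ?_ (by simp [hA0, hS0])
    rw [Derivation.leibniz, derivative_one, derivative_laplace_one, derivative_stirlingSeries]
    simp only [smul_eq_mul]
    ring
  have h2 : rescale (-1) stirlingSeries * stirlingSeries = 1 := by
    refine derivative.ext (R := ℂ) ?_ (by simp [hT0, hS0])
    rw [Derivation.leibniz, derivative_one, derivative_rescale_neg_one, derivative_stirlingSeries,
      map_mul, rescale_neg_one_derivative_stirlingExponent]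
    simp only [smul_eq_mul]
    ring
  exact mul_right_cancel₀ hne (h1.trans h2.symm)

/-- The odd coefficients of the inverse series `1/t = tau(v)`. -/
theorem doubleFactorial_mul_coeff_tau (k : ℕ) :
    (((2 * k + 1)‼ : ℕ) : ℂ) * coeff (2 * k + 1) tau = (-1) ^ k * stirlingCoeff k := by
  have h := congrArg (coeff k) laplace_one
  rw [laplace_apply, coeff_gaussMoment, subst_one hasSubst_tau, one_mul, coeff_derivative, coeff_rescale,
    coeff_stirlingSeries] at h
  rw [← h, doubleFactorial_two_mul_add_one]
  push_cast
  ring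

-- The field of Laurent series

local notation "ofPS" => HahnSeries.ofPowerSeries ℤ ℂ

/-- The uniformizer `X` of the field of Laurent series. -/
def uniformizer : ℂ⸨X⸩ := HahnSeries.single 1 1

local notation "ϖ" => uniformizer

lemma uniformizer_ne_zero : ϖ ≠ 0 := HahnSeries.single_ne_zero one_ne_zero

lemma ofPowerSeries_X_eq : ofPS X = ϖ := HahnSeries.ofPowerSeries_X

lemma single_eq_zpow (n : ℤ) : (HahnSeries.single n 1 : ℂ⸨X⸩) = ϖ ^ n :=
  RatFunc.single_zpow n

lemma t_eq : t = ϖ⁻¹ := by rw [t, single_eq_zpow, zpow_neg_one]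

lemma ofPowerSeries_C_ofNat (n : ℕ) [n.AtLeastTwo] :
    ofPS (C (OfNat.ofNat n : ℂ)) = OfNat.ofNat n := by
  rw [map_ofNat, map_ofNat]

instance : CharZero ℂ⸨X⸩ :=
  charZero_of_injective_ringHom (HahnSeries.C_injective (Γ := ℤ) (R := ℂ))

lemma ofPowerSeries_C_half : ofPS (C (1 / 2 : ℂ)) = 1 / 2 := by
  have h : ofPS (C (1 / 2 : ℂ)) * 2 = 1 := by
    rw [← ofPowerSeries_C_ofNat 2, ← map_mul, ← map_mul]; norm_num
  rw [eq_div_iff two_ne_zero, h]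

lemma ofPowerSeries_ne_zero {f : ℂ⟦X⟧} (hf : f ≠ 0) : ofPS f ≠ 0 := by
  rw [Ne, map_eq_zero_iff _ HahnSeries.ofPowerSeries_injective]; exact hf

lemma exists_eq_zpow_mul (f : ℂ⸨X⸩) : f = ϖ ^ f.order * ofPS f.powerSeriesPart := by
  rw [← single_eq_zpow, LaurentSeries.single_order_mul_powerSeriesPart]

/-! ### The derivation `t² (t - 1) d/dt` -/

lemma coeff_derivative_laurent (f : ℂ⸨X⸩) (n : ℤ) :
    (LaurentSeries.derivative ℂ f).coeff n = ((n : ℂ) + 1) * f.coeff (n + 1) := by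
  rw [LaurentSeries.derivative_apply, LaurentSeries.hasseDeriv_coeff]
  simp

lemma derivative_zpow_mul (n : ℤ) (g : ℂ⟦X⟧) :
    LaurentSeries.derivative ℂ (ϖ ^ n * ofPS g) =
      ϖ ^ n * ((n : ℂ⸨X⸩) * ϖ⁻¹ * ofPS g + ofPS (d⁄dX ℂ g)) := by
  have e : ϖ ^ n * ((n : ℂ⸨X⸩) * ϖ⁻¹ * ofPS g + ofPS (d⁄dX ℂ g)) =
      HahnSeries.single (n - 1) 1 * ofPS (C (n : ℂ) * g) +
        HahnSeries.single n 1 * ofPS (d⁄dX ℂ g) := by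
    rw [single_eq_zpow, single_eq_zpow, zpow_sub_one₀ uniformizer_ne_zero, map_mul, map_intCast,
      map_intCast]
    ring
  rw [e, ← single_eq_zpow]
  ext m
  rw [coeff_derivative_laurent, HahnSeries.coeff_add,
    HahnSeries.coeff_single_mul, HahnSeries.coeff_single_mul, HahnSeries.coeff_single_mul,
    PowerSeries.coeff_coe, PowerSeries.coeff_coe, PowerSeries.coeff_coe,
    show m + 1 - n = m - n + 1 by ring, show m - (n - 1) = m - n + 1 by ring, coeff_C_mul]
  obtain ⟨i, rfl⟩ : ∃ i, m = n + i := ⟨m - n, by ring⟩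
  rw [show n + i - n = i by ring]
  rcases lt_trichotomy i (-1) with h | rfl | h
  · simp [show i + 1 < 0 by omega, show i < 0 by omega]
  · rw [neg_add_cancel, if_neg (lt_irrefl 0), if_neg (lt_irrefl 0), if_pos (by norm_num)]
    push_cast
    ring
  · obtain ⟨k, rfl⟩ := Int.eq_ofNat_of_zero_le (show 0 ≤ i by omega)
    rw [if_neg (by omega), if_neg (by omega), if_neg (by omega), coeff_derivative,
      show ((k : ℤ) + 1).natAbs = k + 1 by omega, Int.natAbs_natCast]
    push_cast
    ring

/-- An additive map is linear for any two module structures over `ℤ`. -/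
def intLinearMap {A M : Type*} [AddCommGroup A] [AddCommGroup M] (i : Module ℤ A) (j : Module ℤ M)
    (D : A →+ M) : @LinearMap ℤ ℤ _ _ (RingHom.id ℤ) A M _ _ i j :=
  @LinearMap.mk ℤ ℤ _ _ (RingHom.id ℤ) A M _ _ i j D.toAddHom fun n a => by
    obtain rfl : i = AddCommGroup.toIntModule A := Subsingleton.elim _ _
    obtain rfl : j = AddCommGroup.toIntModule M := Subsingleton.elim _ _
    exact map_zsmul D n a

/-- `d/dX` as a derivation of the field of Laurent series. -/
def laurentDerivation : Derivation ℤ ℂ⸨X⸩ ℂ⸨X⸩ :=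
  Derivation.mk' (intLinearMap _ _
      (LaurentSeries.derivative ℂ : ℂ⸨X⸩ →ₗ[ℂ] ℂ⸨X⸩).toAddMonoidHom) fun f g => by
    change LaurentSeries.derivative ℂ _ = f • LaurentSeries.derivative ℂ _ +
      g • LaurentSeries.derivative ℂ _
    rw [exists_eq_zpow_mul f, exists_eq_zpow_mul g]
    generalize f.order = a, g.order = b, f.powerSeriesPart = p, g.powerSeriesPart = q
    have e : ϖ ^ a * ofPS p * (ϖ ^ b * ofPS q) = ϖ ^ (a + b) * ofPS (p * q) := by
      rw [zpow_add₀ uniformizer_ne_zero, map_mul]; ring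
    rw [e, derivative_zpow_mul, derivative_zpow_mul, derivative_zpow_mul, Derivation.leibniz,
      zpow_add₀ uniformizer_ne_zero]
    simp only [smul_eq_mul, map_mul, map_add, Int.cast_add]
    ring

lemma laurentDerivation_zpow_mul (n : ℤ) (g : ℂ⟦X⟧) :
    laurentDerivation (ϖ ^ n * ofPS g) = ϖ ^ n * ((n : ℂ⸨X⸩) * ϖ⁻¹ * ofPS g + ofPS (d⁄dX ℂ g)) :=
  derivative_zpow_mul n g

lemma laurentDerivation_ofPowerSeries (g : ℂ⟦X⟧) :
    laurentDerivation (ofPS g) = ofPS (d⁄dX ℂ g) := by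
  simpa using laurentDerivation_zpow_mul 0 g

/-- The derivation `t² (t - 1) d/dt = -d/dw`. -/
def lambertDerivation : Derivation ℤ ℂ⸨X⸩ ℂ⸨X⸩ := (1 - ϖ⁻¹) • laurentDerivation

lemma lambertDerivation_apply (f : ℂ⸨X⸩) :
    lambertDerivation f = (1 - ϖ⁻¹) * laurentDerivation f := rfl

lemma ddt_eq (f : ℂ⸨X⸩) : ddt f = -(ϖ ^ 2 * laurentDerivation f) := by
  rw [ddt, single_eq_zpow]; rfl

lemma lambertDerivation_eq (f : ℂ⸨X⸩) : lambertDerivation f = t ^ 2 * (t - 1) * ddt f := by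
  rw [ddt_eq, lambertDerivation_apply, t_eq]
  field_simp [uniformizer_ne_zero]
  ring

lemma lambertDerivation_ofPowerSeries (g : ℂ⟦X⟧) :
    lambertDerivation (ofPS g) = (1 - ϖ⁻¹) * ofPS (d⁄dX ℂ g) := by
  rw [lambertDerivation_apply, laurentDerivation_ofPowerSeries]

lemma lambertDerivation_subst {a : ℂ⟦X⟧} (ha : HasSubst a) (g : ℂ⟦X⟧) :
    lambertDerivation (ofPS (g.subst a)) =
      ofPS ((d⁄dX ℂ g).subst a) * lambertDerivation (ofPS a) := by
  rw [lambertDerivation_ofPowerSeries, lambertDerivation_ofPowerSeries, derivative_subst ha,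
    map_mul]
  ring

lemma lambertDerivation_uniformizer : lambertDerivation ϖ = 1 - ϖ⁻¹ := by
  have := lambertDerivation_ofPowerSeries X
  rwa [derivative_X, map_one, mul_one, ofPowerSeries_X_eq] at this

lemma lambertDerivation_t : lambertDerivation t = t ^ 2 * (t - 1) := by
  rw [t_eq, Derivation.leibniz_inv, lambertDerivation_uniformizer, smul_eq_mul]
  ring

lemma lambertDerivation_w : lambertDerivation (ofPS w) = -1 := by
  have h := congrArg ofPS one_sub_X_mul_derivative_w
  rw [map_mul, map_sub, map_one, ofPowerSeries_X_eq] at h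
  rw [lambertDerivation_ofPowerSeries]
  field_simp [uniformizer_ne_zero]
  linear_combination -h

lemma v_ne_zero : v ≠ 0 := fun h => by
  have := v_spec.2.1
  simp [h] at this

lemma v_mul_lambertDerivation_v : ofPS v * lambertDerivation (ofPS v) = -1 := by
  have h := lambertDerivation_w
  have h2 : ofPS w * 2 = ofPS v ^ 2 := by
    rw [← v_spec.2.2, map_mul, map_pow, ofPowerSeries_C_half]; ring
  have h3 := congrArg lambertDerivation h2
  rw [mul_two, map_add, h, Derivation.leibniz_pow] at h3
  simp only [smul_eq_mul, nsmul_eq_mul] at h3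
  push_cast at h3
  refine mul_left_cancel₀ (two_ne_zero (α := ℂ⸨X⸩)) ?_
  linear_combination -h3

/-! ### The deck transformation -/

lemma hasSubst_neg_v : HasSubst (-v) :=
  HasSubst.of_constantCoeff_zero' (by simp [v_spec.1])

lemma sigma_eq : sigma = tau.subst (-v) := by
  refine existsUnique_sigma.unique sigma_spec ⟨?_, fun h => ?_, ?_⟩
  · exact constantCoeff_subst_eq_zero
      (by change constantCoeff (-v) = 0; simp [v_spec.1]) _ constantCoeff_tau
  · have h2 : v.subst (tau.subst (-v) : ℂ⟦X⟧) = -v := by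
      rw [← subst_comp_subst_apply hasSubst_tau hasSubst_neg_v, v_subst_tau,
        subst_X hasSubst_neg_v]
    rw [h, X_subst] at h2
    have := congrArg (coeff 1) h2
    rw [map_neg, v_spec.2.1] at this
    norm_num at this
  · rw [← subst_comp_subst_apply hasSubst_tau hasSubst_neg_v, w_subst_tau,
      subst_C_mul hasSubst_neg_v, subst_pow hasSubst_neg_v, subst_X hasSubst_neg_v, neg_sq,
      v_spec.2.2]

lemma subst_neg_v (f : ℂ⟦X⟧) : f.subst (-v) = ((rescale (-1) f).subst v : ℂ⟦X⟧) := by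
  have hX : HasSubst ((-1 : ℂ) • X : ℂ⟦X⟧) := HasSubst.smul_X' (-1)
  rw [rescale_eq_subst, subst_comp_subst_apply hX hasSubst_v, neg_one_smul]
  congr 1
  rw [← coe_substAlgHom hasSubst_v, map_neg, coe_substAlgHom, subst_X hasSubst_v]

lemma hasSubst_sigma : HasSubst sigma := HasSubst.of_constantCoeff_zero' sigma_spec.1

lemma sigma_ne_zero : sigma ≠ 0 := fun h => by
  have h1 : constantCoeff w = 0 := by
    rw [← coeff_zero_eq_constantCoeff_apply, w, coeff_mk]; simp
  have h2 := sigma_spec.2.2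
  rw [h, subst_zero_of_constantCoeff_zero h1] at h2
  have h3 := congrArg (coeff 2) h2
  simp [w] at h3

/-- Apply D to w(σ) = w and use w'(z) = z/(1-z). Hence s obeys the same differential equation as t.
-/
lemma lambertDerivation_sigma :
    ofPS sigma * lambertDerivation (ofPS sigma) = -(1 - ofPS sigma) := by
  have h1 := lambertDerivation_subst hasSubst_sigma w
  rw [sigma_spec.2.2, lambertDerivation_w] at h1
  have h2 := congrArg (fun f => ofPS (f.subst sigma : ℂ⟦X⟧)) one_sub_X_mul_derivative_w
  simp only [subst_mul hasSubst_sigma, subst_sub hasSubst_sigma, subst_one hasSubst_sigma,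
    subst_X hasSubst_sigma, map_mul, map_sub, map_one] at h2
  linear_combination (-lambertDerivation (ofPS sigma)) * h2 - (1 - ofPS sigma) * h1

lemma lambertDerivation_s : lambertDerivation s = s ^ 2 * (s - 1) := by
  have h0 := ofPowerSeries_ne_zero sigma_ne_zero
  have h := lambertDerivation_sigma
  rw [s, Derivation.leibniz_inv, smul_eq_mul]
  field_simp
  linear_combination -h

/-! ### Substitution of `v(t)` into Laurent series -/

/-- Frees `atV` from the normalization by order: any factorization into a power of the uniformizer
and a power series gives the same value. -/
lemma atV_zpow_mul (n : ℤ) (g : ℂ⟦X⟧) :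
    atV (ϖ ^ n * ofPS g) = ofPS v ^ n * ofPS (g.subst v) := by
  have hV := ofPowerSeries_ne_zero v_ne_zero
  set f := ϖ ^ n * ofPS g with hf
  have h := exists_eq_zpow_mul f
  rw [atV]
  generalize f.order = m at h ⊢
  generalize f.powerSeriesPart = p at h ⊢
  have hsub : ∀ d : ℕ, ∀ q : ℂ⟦X⟧, ofPS ((X ^ d * q).subst v) = ofPS v ^ d * ofPS (q.subst v) := by
    intro d q
    rw [subst_mul hasSubst_v, subst_pow hasSubst_v, subst_X hasSubst_v, map_mul, map_pow]
  have hcancel : ∀ (i : ℤ) (d : ℕ) (q r : ℂ⟦X⟧),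
      ϖ ^ (i + d) * ofPS q = ϖ ^ i * ofPS r → r = X ^ d * q := by
    intro i d q r hh
    rw [zpow_add₀ uniformizer_ne_zero, mul_assoc, zpow_natCast] at hh
    have := mul_left_cancel₀ (zpow_ne_zero i uniformizer_ne_zero) hh
    rw [← ofPowerSeries_X_eq, ← map_pow, ← map_mul] at this
    exact (HahnSeries.ofPowerSeries_injective this).symm
  rcases le_total n m with hnm | hnm
  · obtain ⟨d, rfl⟩ := Int.le.dest hnm
    rw [hcancel n d p g (h.symm.trans hf), hsub, zpow_add₀ hV, zpow_natCast, mul_assoc]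
  · obtain ⟨d, rfl⟩ := Int.le.dest hnm
    rw [hcancel m d g p (hf.symm.trans h), hsub, zpow_add₀ hV, zpow_natCast, mul_assoc]

lemma atV_mul (f g : ℂ⸨X⸩) : atV (f * g) = atV f * atV g := by
  rw [exists_eq_zpow_mul f, exists_eq_zpow_mul g]
  generalize f.order = a, g.order = b, f.powerSeriesPart = p, g.powerSeriesPart = q
  have e : ϖ ^ a * ofPS p * (ϖ ^ b * ofPS q) = ϖ ^ (a + b) * ofPS (p * q) := by
    rw [zpow_add₀ uniformizer_ne_zero, map_mul]; ring
  rw [e, atV_zpow_mul, atV_zpow_mul, atV_zpow_mul,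
    zpow_add₀ (ofPowerSeries_ne_zero v_ne_zero), subst_mul hasSubst_v, map_mul]
  ring

lemma atV_one : atV 1 = 1 := by
  have := atV_zpow_mul 0 1
  simpa [subst_one hasSubst_v] using this

lemma atV_uniformizer : atV ϖ = ofPS v := by
  have := atV_zpow_mul 1 1
  simpa [subst_one hasSubst_v] using this

/-- The chain rule with D v = -1/v. -/
lemma lambertDerivation_atV_zpow_mul (n : ℤ) (g : ℂ⟦X⟧) :
    lambertDerivation (atV (ϖ ^ n * ofPS g)) =
      atV (ϖ ^ (n - 2) * ofPS (-(C (n : ℂ) * g + X * d⁄dX ℂ g))) := by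
  have hV := ofPowerSeries_ne_zero v_ne_zero
  have hδ := v_mul_lambertDerivation_v
  have e : ((-(C (n : ℂ) * g + X * d⁄dX ℂ g)).subst v : ℂ⟦X⟧) =
      -(C (n : ℂ) * g.subst v + v * (d⁄dX ℂ g).subst v) := by
    rw [← coe_substAlgHom hasSubst_v, map_neg, map_add, coe_substAlgHom, subst_C_mul hasSubst_v,
      subst_mul hasSubst_v, subst_X hasSubst_v]
  rw [atV_zpow_mul, atV_zpow_mul, e, Derivation.leibniz, Derivation.leibniz_zpow,
    lambertDerivation_subst hasSubst_v, map_neg, map_add, map_mul, map_mul, map_intCast (C (R := ℂ)),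
    map_intCast, show n = n - 2 + 1 + 1 by ring]
  simp only [smul_eq_mul, zsmul_eq_mul, add_sub_cancel_right, zpow_add_one₀ hV]
  rw [show n - 2 + 1 + 1 = n by ring]
  linear_combination (ofPS v ^ (n - 2) * ((n : ℂ⸨X⸩) * ofPS (g.subst v) +
    ofPS v * ofPS ((d⁄dX ℂ g).subst v))) * hδ

/-! ### The functions `η_n` -/

lemma eta_eq (n : ℤ) : eta n = ϖ ^ (-2 * n - 1) *
    ofPS (evenSeries fun k => stirlingCoeff k * oddDoubleFactorial (n - k)) := by
  rw [eta, single_eq_zpow]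

lemma lambertDerivation_atV_eta (n : ℤ) :
    lambertDerivation (atV (eta n)) = atV (eta (n + 1)) := by
  rw [eta_eq, eta_eq, lambertDerivation_atV_zpow_mul,
    show -2 * n - 1 - 2 = -2 * (n + 1) - 1 by ring]
  congr 3
  ext j
  rw [map_neg, map_add, coeff_C_mul, evenSeries, evenSeries, coeff_mk, coeff_mk]
  rcases j with _ | j
  · have := oddDoubleFactorial_add_one n
    simp [this]
    ring
  · rw [coeff_succ_X_mul, coeff_derivative, coeff_mk]
    split_ifs with h
    · obtain ⟨k, hk⟩ := h
      rw [hk, show (k + k) / 2 = k by omega, show n + 1 - (k : ℤ) = n - k + 1 by ring,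
        oddDoubleFactorial_add_one]
      have hk' : (j : ℂ) + 1 = k + k := by exact_mod_cast hk
      rw [hk']
      push_cast
      ring
    · simp

lemma oddDoubleFactorial_neg_one_sub (k : ℕ) :
    oddDoubleFactorial (-1 - k) = (-1) ^ (k + 1) / ((2 * k + 1)‼ : ℕ) := by
  rw [show (-1 - k : ℤ) = Int.negSucc k by rw [Int.negSucc_eq]; ring]
  rfl

lemma eta_neg_one : eta (-1) =
    -(HahnSeries.single 1 1 * (1 + ofPS (evenSeries fun k =>
      if k = 0 then 0 else (-1) ^ k * stirlingCoeff k / ((2 * k + 1)‼ : ℕ)))) := by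
  rw [eta_eq, show -2 * (-1 : ℤ) - 1 = 1 by norm_num, zpow_one, single_eq_zpow, zpow_one]
  have hneg : ∀ f g : ℂ⸨X⸩, -(f * g) = f * -g := fun f g => by ring
  rw [hneg, ← map_one ofPS, ← map_add, ← map_neg]
  congr 2
  ext j
  rw [map_neg, map_add, evenSeries, evenSeries, coeff_mk, coeff_mk, coeff_one]
  by_cases h : Even j
  · obtain ⟨k, rfl⟩ := h
    rw [if_pos (show Even (k + k) from ⟨k, rfl⟩), if_pos (show Even (k + k) from ⟨k, rfl⟩),
      show (k + k) / 2 = k by omega,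
      oddDoubleFactorial_neg_one_sub]
    rcases k with _ | k
    · simp [stirlingCoeff_zero]
    · rw [if_neg (by omega), if_neg (by omega)]
      ring
  · rw [if_neg h, if_neg h, if_neg (fun h0 => h (by simp [h0]))]
    simp

lemma evenSeries_eq_neg_etaTail :
    (evenSeries fun k =>
      if k = 0 then 0 else (-1) ^ k * stirlingCoeff k / ((2 * k + 1)‼ : ℕ)) = -etaTail := by
  ext j
  rw [map_neg, etaTail, evenSeries, evenSeries, coeff_mk, coeff_mk]
  split_ifs with h h0
  · simp
  · obtain ⟨i, hi⟩ := Nat.exists_eq_succ_of_ne_zero h0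
    rw [hi, Nat.succ_eq_add_one, Nat.add_sub_cancel, pow_succ]
    ring
  · simp

lemma geometric_subst_etaTail :
    (1 - etaTail) * (1 + (PowerSeries.mk fun m => if m = 0 then 0 else 1 : ℂ⟦X⟧).subst etaTail) =
      1 := by
  have hT : HasSubst etaTail := HasSubst.of_constantCoeff_zero' (by
    rw [← coeff_zero_eq_constantCoeff_apply, etaTail, evenSeries, coeff_mk]; simp)
  have h : (1 - X) * (1 + (PowerSeries.mk fun m => if m = 0 then 0 else 1 : ℂ⟦X⟧)) = 1 := by
    rw [sub_mul, one_mul]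
    ext n
    rcases n with _ | _ | n
    · simp
    · rw [map_sub, coeff_succ_X_mul]; simp [coeff_one]
    · rw [map_sub, coeff_succ_X_mul]; simp [coeff_one]
  have h2 := congrArg (fun f => f.subst etaTail) h
  simpa only [subst_mul hT, subst_sub hT, subst_add hT, subst_one hT, subst_X hT] using h2

lemma etaReciprocal_eq : etaReciprocal = ϖ ^ (-1 : ℤ) *
    ofPS (-(1 + (PowerSeries.mk fun m => if m = 0 then 0 else 1 : ℂ⟦X⟧).subst etaTail)) := by
  rw [etaReciprocal, single_eq_zpow, map_neg]
  ring

lemma eta_neg_one_mul_etaReciprocal : eta (-1) * etaReciprocal = 1 := by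
  have h := congrArg ofPS geometric_subst_etaTail
  rw [map_mul, map_sub, map_one] at h
  have hϖ : ϖ * ϖ ^ (-1 : ℤ) = 1 := by
    rw [zpow_neg_one, mul_inv_cancel₀ uniformizer_ne_zero]
  rw [eta_neg_one, evenSeries_eq_neg_etaTail, etaReciprocal_eq, map_neg, map_neg, single_eq_zpow,
    zpow_one]
  linear_combination ϖ * ϖ ^ (-1 : ℤ) * h + hϖ

/-- Twice η_{-1} is τ(-v) - τ(v), whose odd coefficients are the Stirling ones; at v = v(t) the two
terms become 1/s and 1/t. -/
lemma atV_eta_neg_one : 2 * atV (eta (-1)) = ofPS sigma - ϖ := by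
  have e : C (2 : ℂ) * (X * evenSeries fun k => stirlingCoeff k * oddDoubleFactorial (-1 - k)) =
      rescale (-1) tau - tau := by
    ext j
    rw [coeff_C_mul, map_sub, coeff_rescale]
    rcases j with _ | j
    · simp
    · rw [coeff_succ_X_mul, evenSeries, coeff_mk]
      split_ifs with h
      · obtain ⟨k, rfl⟩ := h
        rw [← two_mul, show 2 * k / 2 = k by omega, oddDoubleFactorial_neg_one_sub]
        have h1 := doubleFactorial_mul_coeff_tau k
        have h2 : (((2 * k + 1)‼ : ℕ) : ℂ) ≠ 0 := by
          exact_mod_cast (Nat.doubleFactorial_pos _).ne'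
        have h3 : (-1 : ℂ) ^ (2 * k + 1) = -1 := by rw [pow_succ, pow_mul]; norm_num
        rw [h3]
        field_simp
        rw [pow_succ]
        linear_combination 2 * h1
      · rw [Nat.not_even_iff_odd] at h
        rw [Even.neg_one_pow h.add_one]
        simp
  have e2 := congrArg (fun f => ofPS (f.subst v : ℂ⟦X⟧)) e
  simp only [subst_C_mul hasSubst_v] at e2
  simp only [subst_sub hasSubst_v, subst_mul hasSubst_v, subst_X hasSubst_v, ← subst_neg_v,
    ← sigma_eq, tau_subst_v, map_sub, ofPowerSeries_X_eq,
    map_mul] at e2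
  rw [ofPowerSeries_C_ofNat] at e2
  rw [← e2, eta_eq, atV_zpow_mul, show -2 * (-1 : ℤ) - 1 = 1 by norm_num, zpow_one]

/-! ### Odd and even parts of ξ̂_n -/

lemma lambertDerivation_aeval_apply (x : ℂ⸨X⸩) (p : Polynomial ℂ) :
    lambertDerivation (Polynomial.aeval x p) =
      Polynomial.aeval x (Polynomial.derivative p) * lambertDerivation x := by
  induction p using Polynomial.induction_on' with
  | add p q hp hq => simp only [map_add, hp, hq, add_mul]
  | monomial n c =>
    -- The derivation is only ℤ-linear by type, so that it kills complex constants needs proof.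
    have hc : lambertDerivation (algebraMap ℂ ℂ⸨X⸩ c) = 0 := by
      rw [HahnSeries.algebraMap_apply', lambertDerivation_ofPowerSeries]
      have : d⁄dX ℂ (algebraMap ℂ ℂ⟦X⟧ c) = 0 := derivative_C
      rw [this, map_zero, mul_zero]
    rw [Polynomial.derivative_monomial, Polynomial.aeval_monomial, Polynomial.aeval_monomial,
      Derivation.leibniz, hc, Derivation.leibniz_pow, map_mul, map_natCast]
    simp only [smul_eq_mul, nsmul_eq_mul]
    ring

lemma lambertDerivation_aeval {x : ℂ⸨X⸩} (hx : lambertDerivation x = x ^ 2 * (x - 1)) (n : ℕ) :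
    lambertDerivation (Polynomial.aeval x (xiHat n)) = Polynomial.aeval x (xiHat (n + 1)) := by
  rw [lambertDerivation_aeval_apply, hx, xiHat]
  simp only [map_mul, map_pow, map_sub, Polynomial.aeval_X, map_one]
  ring

lemma s_mul_sigma : s * ofPS sigma = 1 := by
  rw [s, inv_mul_cancel₀ (ofPowerSeries_ne_zero sigma_ne_zero)]

lemma lambertDerivation_two_mul (f : ℂ⸨X⸩) :
    lambertDerivation (2 * f) = 2 * lambertDerivation f := by
  rw [two_mul, map_add, two_mul]

/-- The odd part of `ξ̂_n` is `η_n`. -/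
lemma atV_eta (n : ℕ) : 2 * atV (eta n) =
    Polynomial.aeval t (xiHat n) - Polynomial.aeval s (xiHat n) := by
  induction n with
  | zero =>
    have h := congrArg lambertDerivation atV_eta_neg_one
    rw [lambertDerivation_two_mul, lambertDerivation_atV_eta, map_sub,
      lambertDerivation_uniformizer] at h
    have h2 := lambertDerivation_sigma
    have h3 := s_mul_sigma
    rw [Nat.cast_zero, show (0 : ℤ) = -1 + 1 by norm_num, h, xiHat, t_eq]
    simp only [map_sub, Polynomial.aeval_X, map_one]
    linear_combination s * h2 - (lambertDerivation (ofPS sigma) - 1) * h3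
  | succ n ih =>
    have h := congrArg lambertDerivation ih
    rw [lambertDerivation_two_mul, lambertDerivation_atV_eta, map_sub,
      lambertDerivation_aeval lambertDerivation_t, lambertDerivation_aeval lambertDerivation_s] at h
    exact_mod_cast h

/-- The even part of `ξ̂_n` is a power series in `v²`. -/
lemma exists_aeval_xiHat_add (n : ℕ) : ∃ g : ℂ⟦X⟧,
    Polynomial.aeval t (xiHat n) + Polynomial.aeval s (xiHat n) = ofPS (g.subst (v ^ 2)) := by
  have hv2 : HasSubst (v ^ 2) := HasSubst.of_constantCoeff_zero' (by simp [v_spec.1])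
  induction n with
  | zero =>
    -- With τ = vρ, the poles cancel in t + s = (ρ⁻¹(v) - ρ⁻¹(-v))/v, and the numerator is odd.
    obtain ⟨ρ, hρ⟩ := X_dvd_iff.mpr constantCoeff_tau
    have hρ0 : constantCoeff ρ ≠ 0 := by
      have h1 := coeff_one_tau
      rw [hρ, show (1 : ℕ) = 0 + 1 from rfl, coeff_succ_X_mul,
        coeff_zero_eq_constantCoeff_apply] at h1
      rw [h1]; exact one_ne_zero
    have hr : ρ * ρ⁻¹ = 1 := PowerSeries.mul_inv_cancel ρ hρ0
    set k : ℂ⟦X⟧ := PowerSeries.mk fun i => 2 * coeff (2 * i + 1) ρ⁻¹ with hk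
    have hodd : ρ⁻¹ - rescale (-1) ρ⁻¹ = X * (k.subst (X ^ 2 : ℂ⟦X⟧) : ℂ⟦X⟧) := by
      ext j
      rw [map_sub, coeff_rescale]
      rcases j with _ | j
      · simp
      · rw [coeff_succ_X_mul, coeff_subst_X_pow two_ne_zero, hk]
        split_ifs with h
        · obtain ⟨i, rfl⟩ := h
          have h3 : (-1 : ℂ) ^ (2 * i + 1) = -1 := by rw [pow_succ, pow_mul]; norm_num
          rw [h3, show 2 * i / 2 = i by omega, coeff_mk]
          simp
          ring
        · have : Even (j + 1) := by
            rw [Nat.even_iff]; omega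
          rw [this.neg_one_pow]
          ring
    have hodd' := congrArg (fun f => ofPS (f.subst v : ℂ⟦X⟧)) hodd
    simp only [subst_sub hasSubst_v, subst_mul hasSubst_v, subst_X hasSubst_v, ← subst_neg_v,
      map_sub, map_mul, subst_comp_subst_apply (HasSubst.X_pow two_ne_zero) hasSubst_v,
      subst_pow hasSubst_v] at hodd'
    have ht : ϖ = ofPS v * ofPS (ρ.subst v) := by
      rw [← ofPowerSeries_X_eq, ← tau_subst_v, hρ, subst_mul hasSubst_v, subst_X hasSubst_v,
        map_mul]
    have hs : ofPS sigma = -(ofPS v) * ofPS (ρ.subst (-v)) := by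
      rw [sigma_eq, hρ, subst_mul hasSubst_neg_v, subst_X hasSubst_neg_v, map_mul, map_neg]
    have hr1 : ofPS (ρ.subst v) * ofPS (ρ⁻¹.subst v) = 1 := by
      rw [← map_mul, ← subst_mul hasSubst_v, hr, subst_one hasSubst_v, map_one]
    have hr2 : ofPS (ρ.subst (-v)) * ofPS (ρ⁻¹.subst (-v)) = 1 := by
      rw [← map_mul, ← subst_mul hasSubst_neg_v, hr, subst_one hasSubst_neg_v, map_one]
    have hV := ofPowerSeries_ne_zero v_ne_zero
    have hsum : t + s = ofPS (k.subst (v ^ 2)) := by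
      refine mul_left_cancel₀ hV ?_
      rw [← hodd']
      have ht' : ofPS v * t = ofPS (ρ⁻¹.subst v) := by
        have : t * ϖ = 1 := by rw [t_eq, inv_mul_cancel₀ uniformizer_ne_zero]
        rw [ht] at this
        linear_combination ofPS (ρ⁻¹.subst v) * this - ofPS v * t * hr1
      have hs' : ofPS v * s = -ofPS (ρ⁻¹.subst (-v)) := by
        have := s_mul_sigma
        rw [hs] at this
        linear_combination -ofPS (ρ⁻¹.subst (-v)) * this - ofPS v * s * hr2
      rw [mul_add, ht', hs', sub_eq_add_neg]
    refine ⟨k - C 2, ?_⟩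
    have hC : ((C (2 : ℂ)).subst (v ^ 2) : ℂ⟦X⟧) = C 2 := subst_C _
    rw [subst_sub hv2, hC, map_sub, ← hsum, ofPowerSeries_C_ofNat, xiHat]
    simp only [map_sub, Polynomial.aeval_X, map_one]
    ring
  | succ n ih =>
    obtain ⟨g, hg⟩ := ih
    -- On functions of v², D acts as -2 d/d(v²).
    refine ⟨C (-2) * d⁄dX ℂ g, ?_⟩
    have h := congrArg lambertDerivation hg
    rw [map_add, lambertDerivation_aeval lambertDerivation_t,
      lambertDerivation_aeval lambertDerivation_s, lambertDerivation_subst hv2, map_pow,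
      Derivation.leibniz_pow] at h
    rw [h, subst_C_mul hv2, map_mul, map_neg, map_neg, ofPowerSeries_C_ofNat]
    simp only [smul_eq_mul, nsmul_eq_mul]
    push_cast
    linear_combination 2 * ofPS ((d⁄dX ℂ g).subst (v ^ 2)) * v_mul_lambertDerivation_v

/-! ### The residue polynomial -/

lemma polyPart_congr {f g : ℂ⸨X⸩} {h : ℂ⟦X⟧} (hfg : f - g = ofPS (X * h)) :
    polyPart f = polyPart g := by
  ext n
  rw [coeff_polyPart, coeff_polyPart, ← sub_eq_zero, ← HahnSeries.coeff_sub, hfg,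
    PowerSeries.coeff_coe]
  split_ifs with hn
  · rfl
  · obtain rfl : n = 0 := by omega
    simp

lemma residue_kernel : t * s / (t - s) * (1 / (t ^ 2 * (t - 1))) =
    -(1 / 2) * atV etaReciprocal * ofPS v * ddt (ofPS v) := by
  have h1 : atV (eta (-1)) * atV etaReciprocal = 1 := by
    rw [← atV_mul, eta_neg_one_mul_etaReciprocal, atV_one]
  have h2 := v_mul_lambertDerivation_v
  rw [lambertDerivation_eq] at h2
  have h3 := s_mul_sigma
  have h4 : t * ϖ = 1 := by rw [t_eq, inv_mul_cancel₀ uniformizer_ne_zero]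
  have h5 := atV_eta_neg_one
  have hs : s ≠ 0 := left_ne_zero_of_mul_eq_one h3
  have ht : t ≠ 0 := left_ne_zero_of_mul_eq_one h4
  have he : atV (eta (-1)) ≠ 0 := left_ne_zero_of_mul_eq_one h1
  have hts : t - s = t * s * (2 * atV (eta (-1))) := by
    rw [h5]
    linear_combination s * h4 - t * h3
  have e1 : t * s / (t - s) = 1 / 2 * atV etaReciprocal := by
    rw [hts, div_eq_iff (mul_ne_zero (mul_ne_zero ht hs) (mul_ne_zero two_ne_zero he))]
    linear_combination -(t * s) * h1
  have e2 : 1 / (t ^ 2 * (t - 1)) = -(ofPS v * ddt (ofPS v)) := by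
    have h6 : t ^ 2 * (t - 1) * -(ofPS v * ddt (ofPS v)) = 1 := by linear_combination -h2
    rw [div_eq_iff (left_ne_zero_of_mul_eq_one h6), mul_comm, h6]
  rw [e1, e2]
  ring

/-- The factor v cancels the simple pole of 1/η_{-1}, and dv/dt is O(t⁻²). -/
lemma atV_etaReciprocal_mul : ∃ m : ℂ⟦X⟧, atV etaReciprocal * ofPS v * ddt (ofPS v) =
    ϖ ^ 2 * ofPS m := by
  have hV := ofPowerSeries_ne_zero v_ne_zero
  rw [etaReciprocal_eq, atV_zpow_mul]
  set m : ℂ⟦X⟧ := (-(1 + (PowerSeries.mk fun m => if m = 0 then 0 else 1 : ℂ⟦X⟧).subst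
    etaTail) : ℂ⟦X⟧).subst v
  refine ⟨-(m * d⁄dX ℂ v), ?_⟩
  rw [ddt_eq, laurentDerivation_ofPowerSeries, map_neg, map_mul, zpow_neg_one]
  field_simp

lemma residuePolynomial_eq (a b : ℕ) : residuePolynomial a b =
    Polynomial.C (1 / 2) * polyPart (pullbackForm
      (eta (a + 1) * eta (b + 1) * etaReciprocal * HahnSeries.single 1 1)) := by
  obtain ⟨f, hf⟩ := exists_aeval_xiHat_add (a + 1)
  obtain ⟨g, hg⟩ := exists_aeval_xiHat_add (b + 1)
  obtain ⟨m, hm⟩ := atV_etaReciprocal_mul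
  have ha := atV_eta (a + 1)
  have hb := atV_eta (b + 1)
  rw [residuePolynomial]
  congr 1
  -- The discarded term is the product of the even parts; the sums given by f and g are twice those
  -- parts, whence the factor 1/4.
  refine polyPart_congr
    (h := -(C (1 / 2) * C (1 / 2) * X * m * f.subst (v ^ 2) * g.subst (v ^ 2))) ?_
  rw [residue_kernel, pullbackForm, atV_mul, atV_mul, atV_mul, single_eq_zpow, zpow_one,
    atV_uniformizer, ← Nat.cast_succ, ← Nat.cast_succ]
  simp only [map_mul, map_neg, ← hf, ← hg, ofPowerSeries_C_half, ofPowerSeries_X_eq,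
    Nat.succ_eq_add_one]
  generalize Polynomial.aeval t (xiHat (a + 1)) = A at *
  generalize Polynomial.aeval s (xiHat (a + 1)) = A' at *
  generalize Polynomial.aeval t (xiHat (b + 1)) = B at *
  generalize Polynomial.aeval s (xiHat (b + 1)) = B' at *
  obtain rfl : A = 2 * atV (eta ((a + 1 : ℕ) : ℤ)) + A' := by rw [ha]; ring
  obtain rfl : B = 2 * atV (eta ((b + 1 : ℕ) : ℤ)) + B' := by rw [hb]; ring
  linear_combination (-(1 / 4) * (2 * atV (eta ((a + 1 : ℕ) : ℤ)) + 2 * A') *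
    (2 * atV (eta ((b + 1 : ℕ) : ℤ)) + 2 * B')) * hm

end Lambert

end

theorem mainTheorem9 :
    (Lambert.eta (-1) =
      -(HahnSeries.single 1 1 * (1 + HahnSeries.ofPowerSeries ℤ ℂ
        (Lambert.evenSeries fun k =>
          if k = 0 then 0 else (-1) ^ k * Lambert.stirlingCoeff k / ((2 * k + 1)‼ : ℕ))))) ∧
    Lambert.eta (-1) * Lambert.etaReciprocal = 1 ∧
    ∀ a b : ℕ,
      Lambert.residuePolynomial a b =
        Polynomial.C (1 / 2) * Lambert.polyPart
          (Lambert.pullbackForm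
            (Lambert.eta (a + 1) * Lambert.eta (b + 1) * Lambert.etaReciprocal *
              HahnSeries.single 1 1)) :=
  ⟨Lambert.eta_neg_one, Lambert.eta_neg_one_mul_etaReciprocal, Lambert.residuePolynomial_eq⟩
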